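/- \textbf{Setting.} An instance $\mathcal K=(E,\mathcal I,c,p,\beta)$ of \emph{budgeted matroid independent set} (BMI) consists of a matroid $(E,\mathcal I)$ on a finite set $E$, a budget $\beta>0$, a cost function $c:E\to[0,\beta]$ and a profit function $p:E\to\mathbb R_{\ge 0}$. For $X\subseteq E$ write $c(X)=\sum_{e\in X}c(e)$, $p(X)=\sum_{e\in X}p(e)$. A \emph{solution} is a set $X\in\mathcal I$ with $c(X)\le\beta$, and $\mathrm{OPT}(\mathcal K)$ is the maximum profit of a solution. A \emph{$2$-approximation} is a solution $S$ with $p(S)\ge\frac12\mathrm{OPT}(\mathcal K)$. For $0<\varepsilon<\frac12$ let $q(\varepsilon)=\varepsilon^{-\varepsilon^{-1}}$. \textbf{Algorithm} $\mathsf{FindRep}(\mathcal K,\varepsilon)$. Compute a $2$-approximation $S$ and put $\alpha=p(S)$. For each integer $1\le r\le\lfloor\log_{1-\varepsilon}(\varepsilon/2)+1\rfloor$ let $C_r(\alpha)=\{e\in E: p(e)/(2\alpha)\in((1-\varepsilon)^r,(1-\varepsilon)^{r-1}]\}$ (empty if $\alpha=0$). Return a basis of minimum total cost $c$ of the matroid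 whose independent sets are the unions $\bigcup_r A_r$ with $A_r\in\mathcal I$, $A_r\subseteq C_r(\alpha)$ and $|A_r|\le q(\varepsilon)$ for every $r$. \textbf{The linear program.} For $\alpha\ge0$ let $E(\alpha)=\{e\in E: p(e)\le 2\varepsilon\alpha\}$. For a solution $F$ let $P_F(\alpha)$ be the convex hull of the indicator vectors of the sets $A\subseteq E(\alpha)\setminus F$ with $A\cup F\in\mathcal I$, i.e. the matroid polytope of the matroid obtained by contracting $F$ and restricting to $E(\alpha)\setminus F$. $\mathrm{LP}(\mathcal K,F,\alpha)$ asks to maximize $\sum_{e\in E(\alpha)\setminus F}x_e\,p(e)$ over all $x\in P_F(\alpha)$ with $\sum_{e\in E(\alpha)\setminus F}x_e\,c(e)\le\beta-c(F)$. A \emph{basic optimal solution} is a vertex of this feasible region that attains the maximum. \textbf{Algorithm} $\mathsf{EPTAS}(\mathcal K,\varepsilon)$. Let $R=\mathsf{FindRep}(\mathcal K,\varepsilon)$; compute a $2$-approximation $S^*$ and put $\alpha=p(S^*)$; set $A=\emptyset$. For every solution $F\subseteq R$ with $|F|\le\varepsilon^{-1}$ (in any order): find a basic optimal solution $\lambda^F$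 of $\mathrm{LP}(\mathcal K,F,\alpha)$, let $C_F=\{e\in E(\alpha)\setminus F:\lambda^F_e=1\}\cup F$, and if $p(C_F)>p(A)$, replace $A$ by $C_F$. Return $A$. \textbf{Lemma.} For every BMI instance $\mathcal K$ and every $0<\varepsilon<\frac12$, algorithm $\mathsf{EPTAS}(\mathcal K,\varepsilon)$ always returns an output (every step can be carried out, whatever admissible choices were made before); and whatever $2$-approximations, minimum-cost basis, loop order and basic optimal solutions it uses, every set $A$ it returns is a solution of $\mathcal K$ with $$p(A)\ \ge\ (1-7\varepsilon)\cdot\mathrm{OPT}(\mathcal K).$$ -/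

import Mathlib

namespace BMI

/-- An instance of budgeted matroid independent set on the finite ground set `E`: a matroid on `E`,
a budget `β > 0`, costs in `[0, β]` and nonnegative profits. -/
structure Instance (E : Type*) where
  matroid : Matroid E
  ground_eq : matroid.E = Set.univ
  budget : ℝ
  budget_pos : 0 < budget
  cost : E → ℝ
  cost_nonneg : ∀ e, 0 ≤ cost e
  cost_le_budget : ∀ e, cost e ≤ budget
  profit : E → ℝ
  profit_nonneg : ∀ e, 0 ≤ profit e

noncomputable section

/-! ### Families of sets: truncation, union, minimum bases -/

section Families

variable {E : Type*}

/-- The family of (finite) independent sets of a matroid. -/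
def indepSets (M : Matroid E) : Set (Finset E) := {A | M.Indep (A : Set E)}

/-- Truncation: the members of the family with at most `q` elements. -/
def truncation (I : Set (Finset E)) (q : ℝ) : Set (Finset E) := {A ∈ I | (A.card : ℝ) ≤ q}

open Classical in
/-- The family of the matroid union of the families `I r`, `r ∈ s`: all unions of one member of
each `I r`. -/
def familyUnion (s : Finset ℕ) (I : ℕ → Set (Finset E)) : Set (Finset E) :=
  {A | ∃ B : ℕ → Finset E, (∀ r ∈ s, B r ∈ I r) ∧ A = s.biUnion B}

open Classical in
/-- A basis of a family of independent sets: a member that no further element extends to a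
member. -/
def IsBasis (I : Set (Finset E)) (B : Finset E) : Prop :=
  B ∈ I ∧ ∀ e, e ∉ B → insert e B ∉ I

/-- A basis of minimum total weight. -/
def IsMinBasis (I : Set (Finset E)) (w : E → ℝ) (B : Finset E) : Prop :=
  IsBasis I B ∧ ∀ A, IsBasis I A → ∑ e ∈ B, w e ≤ ∑ e ∈ A, w e

/-- The matroid polytope: the convex hull of the indicator vectors of the independent sets
(vectors are indexed by all of `E`, and vanish off the ground set of `M`). -/
def matroidPolytope (M : Matroid E) : Set (E → ℝ) :=
  convexHull ℝ {x | ∃ B : Set E, M.Indep B ∧ x = B.indicator 1}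

end Families

namespace Instance

variable {E : Type*} (K : Instance E)

/-- A solution: an independent set of total cost at most the budget. -/
def IsSolution (X : Finset E) : Prop :=
  K.matroid.Indep (X : Set E) ∧ ∑ e ∈ X, K.cost e ≤ K.budget

/-- The maximum profit of a solution (attained, see `isGreatest_opt`). -/
def opt : ℝ := sSup {v | ∃ X, K.IsSolution X ∧ v = ∑ e ∈ X, K.profit e}

theorem isGreatest_opt [Fintype E] :
    IsGreatest {v | ∃ X, K.IsSolution X ∧ v = ∑ e ∈ X, K.profit e} K.opt := by
  have hfin : {v | ∃ X, K.IsSolution X ∧ v = ∑ e ∈ X, K.profit e}.Finite := by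
    refine (Set.finite_range fun X : Finset E => ∑ e ∈ X, K.profit e).subset ?_
    rintro v ⟨X, -, rfl⟩
    exact ⟨X, rfl⟩
  have hne : {v | ∃ X, K.IsSolution X ∧ v = ∑ e ∈ X, K.profit e}.Nonempty :=
    ⟨_, ∅, ⟨by simp, by simpa using K.budget_pos.le⟩, rfl⟩
  exact ⟨hne.csSup_mem hfin, fun v hv => le_csSup hfin.bddAbove hv⟩

/-- `S` is a solution whose profit is at least half of the optimum: an admissible result of a
PTAS run with error parameter `1/2`. -/
def IsTwoApprox (S : Finset E) : Prop :=
  K.IsSolution S ∧ (1 - 1 / 2) * K.opt ≤ ∑ e ∈ S, K.profit e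

/-! ### Algorithm FindRep -/

/-- `q(ε) = ε ^ (-ε⁻¹)`. -/
def sizeBound (ε : ℝ) : ℝ := ε ^ (-ε⁻¹)

/-- The indices of the profit classes: `1, 2, …, ⌊log_{1-ε}(ε/2) + 1⌋`. -/
def classIndices (ε : ℝ) : Finset ℕ := Finset.Icc 1 ⌊Real.logb (1 - ε) (ε / 2) + 1⌋₊

/-- The `r`-th profit class `{e | p(e)/(2α) ∈ ((1-ε)^r, (1-ε)^(r-1)]}`, used for `r ≥ 1` only.
(For `α = 0` all classes are empty.) -/
def profitClass (ε α : ℝ) (r : ℕ) : Set E :=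
  {e | K.profit e / (2 * α) ∈ Set.Ioc ((1 - ε) ^ r) ((1 - ε) ^ (r - 1))}

/-- The independent sets of the union, over all profit classes, of the matroid restricted to the
class and truncated at `q(ε)`. -/
def repFamily (ε α : ℝ) : Set (Finset E) :=
  familyUnion (classIndices ε) fun r =>
    truncation (indepSets (K.matroid.restrict (K.profitClass ε α r))) (sizeBound ε)

/-- `R` is a possible result of `FindRep(K, ε)` once its 2-approximate solution `S` is chosen: a
minimum-cost basis of the union matroid for `α = p(S)`. -/
def IsFindRepResult (ε : ℝ) (S R : Finset E) : Prop :=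
  IsMinBasis (K.repFamily ε (∑ e ∈ S, K.profit e)) K.cost R

/-- `R` is a possible output of `FindRep(K, ε)`. -/
def IsFindRepOutput (ε : ℝ) (R : Finset E) : Prop :=
  ∃ S, K.IsTwoApprox S ∧ K.IsFindRepResult ε S R

/-! ### The linear program -/

/-- `E(α)`: the elements of profit at most `2εα`. -/
def lowProfit (ε α : ℝ) : Set E := {e | K.profit e ≤ 2 * ε * α}

/-- The matroid `M_F(α)`: contract `F`, then restrict to the remaining elements of `E(α)`. -/
def residualMatroid (ε α : ℝ) (F : Finset E) : Matroid E :=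
  (K.matroid.contract (F : Set E)).restrict (K.lowProfit ε α \ (F : Set E))

open Classical in
/-- `E(α) \ F` as a finset. -/
def lpVars [Fintype E] (ε α : ℝ) (F : Finset E) : Finset E :=
  {e | e ∈ K.lowProfit ε α ∧ e ∉ F}

/-- The feasible region of `LP(K, F, α)`: the points of the polytope of `M_F(α)` within the residual
budget. -/
def lpFeasible [Fintype E] (ε α : ℝ) (F : Finset E) : Set (E → ℝ) :=
  {x | x ∈ matroidPolytope (K.residualMatroid ε α F) ∧
    ∑ e ∈ K.lpVars ε α F, x e * K.cost e ≤ K.budget - ∑ e ∈ F, K.cost e}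

/-- `x` is a basic optimal solution of `LP(K, F, α)`: a vertex of the feasible region that maximizes
the objective. -/
def IsBasicOptimal [Fintype E] (ε α : ℝ) (F : Finset E) (x : E → ℝ) : Prop :=
  x ∈ (K.lpFeasible ε α F).extremePoints ℝ ∧
    ∀ y ∈ K.lpFeasible ε α F,
      ∑ e ∈ K.lpVars ε α F, y e * K.profit e ≤ ∑ e ∈ K.lpVars ε α F, x e * K.profit e

/-! ### Algorithm EPTAS -/

/-- The sets `F` over which the main loop runs. -/
def IsCandidate (ε : ℝ) (R F : Finset E) : Prop :=
  F ⊆ R ∧ (F.card : ℝ) ≤ ε⁻¹ ∧ K.IsSolution F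

open Classical in
/-- `C_F = {e ∈ E(α) \ F | x e = 1} ∪ F`. -/
def extend [Fintype E] (ε α : ℝ) (F : Finset E) (x : E → ℝ) : Finset E :=
  {e ∈ K.lpVars ε α F | x e = 1} ∪ F

open Classical in
/-- The body of the main loop: replace `A` by `C` if `C` has larger profit. -/
def update (A C : Finset E) : Finset E :=
  if ∑ e ∈ A, K.profit e < ∑ e ∈ C, K.profit e then C else A

/-- `A` is a possible result of the main loop of `EPTAS(K, ε)`, started from `A = ∅`, for the
representative set `R` and the 2-approximate solution `S` (so `α = p(S)`): the candidate sets are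
visited once each in some order, and `sol F` is the basic optimal solution found for `F`. -/
def IsLoopResult [Fintype E] (ε : ℝ) (R S A : Finset E) : Prop :=
  ∃ (order : List (Finset E)) (sol : Finset E → E → ℝ),
    order.Nodup ∧ (∀ F, F ∈ order ↔ K.IsCandidate ε R F) ∧
    (∀ F ∈ order, K.IsBasicOptimal ε (∑ e ∈ S, K.profit e) F (sol F)) ∧
    A = order.foldl
      (fun A F => K.update A (K.extend ε (∑ e ∈ S, K.profit e) F (sol F))) ∅

/-- `A` is a possible output of `EPTAS(K, ε)`. -/
def IsEPTASOutput [Fintype E] (ε : ℝ) (A : Finset E) : Prop :=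
  ∃ R S, K.IsFindRepOutput ε R ∧ K.IsTwoApprox S ∧ K.IsLoopResult ε R S A

/-- No execution of `EPTAS(K, ε)` gets stuck: each step can be carried out, whatever admissible
choices were made in the steps before it. -/
def EPTASTerminates [Fintype E] (ε : ℝ) : Prop :=
  (∃ S, K.IsTwoApprox S) ∧
  (∀ S, K.IsTwoApprox S → ∃ R, K.IsFindRepResult ε S R) ∧
  (∀ R S, K.IsFindRepOutput ε R → K.IsTwoApprox S → ∃ A, K.IsLoopResult ε R S A)

end Instance

end

end BMI

/-!
The analysis compares the output with an optimal solution `G` of profit `OPT`, in two steps.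

*Representative set.* Since the profit classes are disjoint, a minimum-cost basis `R` of the union
of the truncated restrictions is a minimum-cost basis in every class separately. Hence an element
`e` of a class lying in an independent set `L` of at most `q(ε)` elements can be exchanged with an
element of `R` in the same class that costs no more (`BMI.exists_exchange_of_isMinBasis`), and
whose profit is at least `1 - ε` times as large. Among the `⌊ε⁻¹⌋ + 1` profit ranges
`(ε ^ (i + 1) * OPT, ε ^ i * OPT]`, `0 ≤ i ≤ ε⁻¹`, one contributes at most `ε * OPT` to `G` and is
dropped. There are at most `ε ^ (-i) ≤ q(ε)` elements of `G` above this range, so that those in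
profit classes can all be exchanged for elements of `R`. To keep the set independent, at most as many elements below the
range have to be removed, of profit at most `ε ^ (i + 1) * OPT` each. Altogether at most
`3 * ε * OPT` is lost, and all elements of profit more than `ε * OPT` of the resulting solution `T`
belong to `R` (`BMI.Instance.exists_solution_profitable_subset`).

*Rounding.* The main loop visits the set `F` of the elements of `T` of profit more than `2 * ε * α`,
and the indicator vector of `T \ F` is feasible for the linear program of `F`. A vertex of a
polytope cut by a halfspace lies on a face of dimension at most one of the polytope. For a matroid
polytope, exchange between two independent sets shows that such a face is parallel to a difference
of indicator vectors of two independent sets that differ in at most two elements, so that a vertex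
of the feasible region has at most two fractional entries
(`BMI.exists_card_le_two_of_mem_extremePoints`). Rounding them down loses at most
`2 * (2 * ε * α) ≤ 4 * ε * OPT`.

The two runs of the 2-approximation may give different values of `α`; only
`OPT / 2 ≤ α ≤ OPT` is used. No step gets stuck: bases exist as the ground set is finite, and basic
optimal solutions exist as the feasible regions are nonempty and compact.
-/

namespace BMI

/-! ### Exchange properties of matroids -/

section Exchange

variable {E : Type*} {M : Matroid E}

/-- If `e` is not spanned by the proper subset `D` of the independent set `J`, then `e` can be
exchanged with an element of `J` outside `D`: the fundamental circuit of `e` in `J` is not contained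
in `insert e D`. -/
theorem exists_indep_exchange {J D : Set E} {e : E} (hJ : M.Indep J) (hDJ : D ⊆ J) (hne : D ≠ J)
    (he : e ∈ M.E) (heD : e ∉ M.closure D) (heJ : e ∉ J) :
    ∃ g ∈ J \ D, M.Indep (insert e J \ {g}) := by
  by_cases hcl : e ∈ M.closure J
  · by_contra! hcon
    have hC := hJ.fundCircuit_isCircuit hcl heJ
    refine heD (M.closure_subset_closure ?_
      (hC.mem_closure_sdiff_singleton_of_mem (M.mem_fundCircuit e J)))
    rintro g ⟨hg, hge⟩
    have hgJ : g ∈ J := (M.fundCircuit_subset_insert e J hg).resolve_left hge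
    by_contra hgD
    exact hcon g ⟨hgJ, hgD⟩ ((hJ.mem_fundCircuit_iff hcl heJ).1 hg)
  · obtain ⟨g, hgJ, hgD⟩ := Set.exists_of_ssubset (hDJ.ssubset_of_ne hne)
    exact ⟨g, ⟨hgJ, hgD⟩, ((hJ.notMem_closure_iff_of_notMem heJ he).1 hcl).subset Set.sdiff_subset⟩

/-- Two distinct independent sets `I`, `J` admit a simultaneous exchange: the multiset union of `I`
and `J` is also that of two independent sets `I'`, `J'`, where `I'` differs from `I`, but in at most
two elements. -/
theorem exists_double_exchange [Finite E] {I J : Set E} (hI : M.Indep I) (hJ : M.Indep J)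
    (hIJ : I ≠ J) :
    ∃ (I' J' : Set E) (s : Finset E), M.Indep I' ∧ M.Indep J' ∧ I' ≠ I ∧ s.card ≤ 2 ∧
      (∀ e ∉ s, (e ∈ I' ↔ e ∈ I)) ∧
      (I'.indicator 1 - I.indicator 1 : E → ℝ) = J.indicator 1 - J'.indicator 1 := by
  classical
  rcases lt_trichotomy I.encard J.encard with hlt | heq | hlt
  · obtain ⟨j, ⟨hjJ, hjI⟩, hind⟩ := hI.augment hJ hlt
    refine ⟨insert j I, J \ {j}, {j}, hind, hJ.subset Set.sdiff_subset, ?_, by simp, ?_, ?_⟩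
    · exact fun h => hjI (h ▸ Set.mem_insert j I)
    · intro e he
      have : e ≠ j := by simpa using he
      simp [this]
    · ext e
      by_cases he : e = j <;> simp [Set.indicator_apply, he, hjI, hjJ]
  · obtain ⟨i, hiI, hiJ⟩ : ∃ i ∈ I, i ∉ J := by
      by_contra! h
      exact hIJ ((Set.toFinite _).eq_of_subset_of_encard_le (fun i hi => h i hi) heq.ge)
    have hI' : M.Indep (I \ {i}) := hI.subset Set.sdiff_subset
    have hiD : i ∉ M.closure (J ∩ M.closure (I \ {i})) := fun h =>
      hI.notMem_closure_sdiff_of_mem hiI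
        (M.closure_subset_closure_of_subset_closure Set.inter_subset_right h)
    have hne : J ∩ M.closure (I \ {i}) ≠ J := by
      intro h
      have h1 : J.encard ≤ (I \ {i}).encard := by
        rw [← hJ.eRk_eq_encard, ← hI'.eRk_eq_encard, ← M.eRk_closure_eq (I \ {i})]
        exact M.eRk_mono (Set.inter_eq_left.1 h)
      have h2 := Set.encard_sdiff_singleton_add_one hiI
      rw [heq] at h2
      have h3 : (I \ {i}).encard ≠ ⊤ := Set.encard_ne_top_iff.2 (Set.toFinite _)
      rw [← h2] at h1
      exact absurd h1 (not_le.2 (ENat.lt_add_one_iff h3 |>.2 le_rfl))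
    obtain ⟨j, ⟨hjJ, hjD⟩, hind⟩ := exists_indep_exchange hJ Set.inter_subset_left hne
      (hI.subset_ground hiI) hiD hiJ
    have hjcl : j ∉ M.closure (I \ {i}) := fun h => hjD ⟨hjJ, h⟩
    have hji : j ≠ i := fun h => hiJ (h ▸ hjJ)
    have hjI : j ∉ I := fun h => hjcl (M.mem_closure_of_mem ⟨h, hji⟩ hI'.subset_ground)
    refine ⟨insert j (I \ {i}), insert i J \ {j}, {i, j}, ?_, hind, ?_, Finset.card_le_two, ?_, ?_⟩
    · exact (hI'.notMem_closure_iff_of_notMem (fun h => hjI h.1) (hJ.subset_ground hjJ)).1 hjcl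
    · exact fun h => hjI (h ▸ Set.mem_insert j _)
    · intro e he
      simp only [Finset.mem_insert, Finset.mem_singleton, not_or] at he
      simp [he.1, he.2]
    · ext e
      by_cases he : e = j
      · subst he
        simp [hjI, hjJ]
      · by_cases he' : e = i
        · subst he'
          simp [hiI, hiJ, he]
        · simp [Set.indicator_apply, he, he']
  · obtain ⟨j, ⟨hjI, hjJ⟩, hind⟩ := hJ.augment hI hlt
    refine ⟨I \ {j}, insert j J, {j}, hI.subset Set.sdiff_subset, hind, ?_, by simp, ?_, ?_⟩
    · exact fun h => (h.symm.subset hjI).2 rfl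
    · intro e he
      have : e ≠ j := by simpa using he
      simp [this]
    · ext e
      by_cases he : e = j <;> simp [Set.indicator_apply, he, hjI, hjJ]

end Exchange

/-! ### Vertices of a matroid polytope cut by a halfspace -/

section Vertices

/-- The direction `d` can be followed a positive distance forwards and backwards from `x` inside
`P`. -/
def FeasibleDir {V : Type*} [AddCommGroup V] [Module ℝ V] (P : Set V) (x d : V) : Prop :=
  ∃ δ : ℝ, 0 < δ ∧ x + δ • d ∈ P ∧ x - δ • d ∈ P

section

variable {V : Type*} [AddCommGroup V] [Module ℝ V] {P : Set V} {x d d₁ d₂ : V}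

theorem feasibleDir_of_pos (hP : Convex ℝ P) {δ₁ δ₂ : ℝ} (h₁ : 0 < δ₁) (h₂ : 0 < δ₂)
    (hx : x ∈ P) (hxp : x + δ₁ • d ∈ P) (hxm : x - δ₂ • d ∈ P) : FeasibleDir P x d := by
  refine ⟨min δ₁ δ₂, lt_min h₁ h₂, ?_, ?_⟩
  · have := hP.add_smul_mem hx hxp (t := min δ₁ δ₂ / δ₁)
      ⟨by positivity, (div_le_one h₁).2 (min_le_left _ _)⟩
    rwa [smul_smul, div_mul_cancel₀ _ h₁.ne'] at this
  · rw [sub_eq_add_neg] at hxm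
    have := hP.add_smul_mem hx hxm (t := min δ₁ δ₂ / δ₂)
      ⟨by positivity, (div_le_one h₂).2 (min_le_right _ _)⟩
    rwa [smul_neg, smul_smul, div_mul_cancel₀ _ h₂.ne', ← sub_eq_add_neg] at this

theorem FeasibleDir.smul (hd : FeasibleDir P x d) (hx : x ∈ P) (a : ℝ) :
    FeasibleDir P x (a • d) := by
  obtain ⟨δ, hδ, hp, hm⟩ := hd
  rcases lt_trichotomy a 0 with ha | rfl | ha
  · refine ⟨δ / -a, div_pos hδ (neg_pos.2 ha), ?_, ?_⟩
    · rw [smul_smul, show δ / -a * a = -δ by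
        rw [div_neg, neg_mul, div_mul_cancel₀ _ ha.ne], neg_smul, ← sub_eq_add_neg]
      exact hm
    · rw [smul_smul, show δ / -a * a = -δ by
        rw [div_neg, neg_mul, div_mul_cancel₀ _ ha.ne], neg_smul, sub_neg_eq_add]
      exact hp
  · exact ⟨1, one_pos, by simpa using hx, by simpa using hx⟩
  · refine ⟨δ / a, div_pos hδ ha, ?_, ?_⟩ <;> rwa [smul_smul, div_mul_cancel₀ _ ha.ne']

theorem FeasibleDir.add (hP : Convex ℝ P) (h₁ : FeasibleDir P x d₁) (h₂ : FeasibleDir P x d₂) :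
    FeasibleDir P x (d₁ + d₂) := by
  obtain ⟨δ₁, hδ₁, hp₁, hm₁⟩ := h₁
  obtain ⟨δ₂, hδ₂, hp₂, hm₂⟩ := h₂
  -- the weights `δ₂ / (δ₁ + δ₂)` and `δ₁ / (δ₁ + δ₂)` give both directions the same step length,
  -- half the harmonic mean of `δ₁` and `δ₂`
  have hs : 0 < δ₁ + δ₂ := by positivity
  have hsum : δ₂ / (δ₁ + δ₂) + δ₁ / (δ₁ + δ₂) = 1 := by field_simp; ring
  refine ⟨δ₁ * δ₂ / (δ₁ + δ₂), by positivity, ?_, ?_⟩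
  · have := hP hp₁ hp₂ (a := δ₂ / (δ₁ + δ₂)) (b := δ₁ / (δ₁ + δ₂)) (by positivity) (by positivity)
      hsum
    convert this using 1
    match_scalars <;> field_simp
    ring
  · have := hP hm₁ hm₂ (a := δ₂ / (δ₁ + δ₂)) (b := δ₁ / (δ₁ + δ₂)) (by positivity) (by positivity)
      hsum
    convert this using 1
    match_scalars <;> field_simp
    ring

/-- At a vertex of `P ∩ {ℓ ≤ b}`, no nonzero feasible direction of `P` is parallel to the hyperplane:
otherwise the vertex would be the midpoint of a segment of `P` along which `ℓ` is constant. -/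
theorem FeasibleDir.eq_zero (ℓ : V →ₗ[ℝ] ℝ) {b : ℝ}
    (hx : x ∈ {y ∈ P | ℓ y ≤ b}.extremePoints ℝ) (hd : FeasibleDir P x d) (hℓ : ℓ d = 0) :
    d = 0 := by
  obtain ⟨δ, hδ, hp, hm⟩ := hd
  have hmem : x ∈ openSegment ℝ (x + δ • d) (x - δ • d) :=
    ⟨1 / 2, 1 / 2, by norm_num, by norm_num, by norm_num, by module⟩
  have := hx.2 (x₁ := x + δ • d) (x₂ := x - δ • d) ⟨hp, by simpa [hℓ] using hx.1.2⟩
    ⟨hm, by simpa [hℓ] using hx.1.2⟩ hmem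
  exact (smul_eq_zero.1 (add_eq_left.1 this)).resolve_left hδ.ne'

/-- At a vertex of `P ∩ {ℓ ≤ b}`, all feasible directions of `P` are parallel. -/
theorem FeasibleDir.smul_eq_smul (hP : Convex ℝ P) (ℓ : V →ₗ[ℝ] ℝ) {b : ℝ}
    (hx : x ∈ {y ∈ P | ℓ y ≤ b}.extremePoints ℝ) (h₁ : FeasibleDir P x d₁)
    (h₂ : FeasibleDir P x d₂) : ℓ d₂ • d₁ = ℓ d₁ • d₂ := by
  have h0 := ((h₁.smul hx.1.1 (ℓ d₂)).add hP (h₂.smul hx.1.1 (-ℓ d₁))).eq_zero ℓ hx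
    (by simp; ring)
  rw [neg_smul, ← sub_eq_add_neg] at h0
  exact sub_eq_zero.1 h0

/-- Moving weight in a convex combination from one of its points to another point of the convex
set. -/
theorem add_smul_sub_mem_of_sum {ι : Type*} {t : Finset ι} {w : ι → ℝ} {z : ι → V}
    (hP : Convex ℝ P) (hw : ∀ i ∈ t, 0 ≤ w i) (hw1 : ∑ i ∈ t, w i = 1) (hz : ∀ i ∈ t, z i ∈ P)
    {i : ι} (hi : i ∈ t) {v : V} (hv : v ∈ P) :
    ∑ k ∈ t, w k • z k + w i • (v - z i) ∈ P := by
  classical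
  have : ∑ k ∈ t, w k • z k + w i • (v - z i) = ∑ k ∈ t, w k • Function.update z i v k := by
    rw [← Finset.add_sum_erase _ _ hi, ← Finset.add_sum_erase _ (fun k => w k • _) hi,
      Finset.sum_congr rfl (g := fun k => w k • z k) (s₁ := t.erase i) (s₂ := t.erase i)
        (f := fun k => w k • Function.update z i v k)]
    · simp only [Function.update_self]
      module
    · intro k hk
      rw [Function.update_of_ne (Finset.ne_of_mem_erase hk)]
  rw [this]
  refine hP.sum_mem hw hw1 fun k hk => ?_
  by_cases hki : k = i
  · simpa [hki] using hv
  · simpa [hki] using hz k hk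

end

variable {E : Type*}

theorem indicator_mem_matroidPolytope {M : Matroid E} {B : Set E} (hB : M.Indep B) :
    (B.indicator 1 : E → ℝ) ∈ matroidPolytope M :=
  subset_convexHull ℝ _ ⟨B, hB, rfl⟩

theorem convex_matroidPolytope (M : Matroid E) : Convex ℝ (matroidPolytope M) :=
  convex_convexHull ℝ _

/-- A vertex of a matroid polytope cut by a halfspace has at most two fractional entries. Indeed it
lies on a face of dimension at most one of the polytope, and if two different independent sets
occur in it as a convex combination, then that face is parallel to the direction given by their
double exchange. -/
theorem exists_card_le_two_of_mem_extremePoints [Finite E] (M : Matroid E) (ℓ : (E → ℝ) →ₗ[ℝ] ℝ)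
    {b : ℝ} {x : E → ℝ} (hx : x ∈ {y ∈ matroidPolytope M | ℓ y ≤ b}.extremePoints ℝ) :
    ∃ s : Finset E, s.card ≤ 2 ∧ ∀ e ∉ s, x e = 0 ∨ x e = 1 := by
  have hP := convex_matroidPolytope M
  have hxP : x ∈ matroidPolytope M := hx.1.1
  have hxP' := hxP
  rw [matroidPolytope, convexHull_eq] at hxP'
  obtain ⟨ι, t, w, z, hw, hw1, hz, hzx⟩ := hxP'
  rw [Finset.centerMass_eq_of_sum_1 _ _ hw1] at hzx
  have hzP : ∀ k ∈ t, z k ∈ matroidPolytope M := fun k hk => subset_convexHull ℝ _ (hz k hk)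
  have hmove : ∀ k ∈ t, ∀ v ∈ matroidPolytope M, x + w k • (v - z k) ∈ matroidPolytope M := by
    intro k hk v hv
    rw [← hzx]
    exact add_smul_sub_mem_of_sum hP hw hw1 hzP hk hv
  obtain ⟨i, hi, hwi⟩ : ∃ i ∈ t, 0 < w i := by
    by_contra! h
    have := Finset.sum_nonpos h
    linarith
  obtain ⟨I, hI, hzI⟩ := hz i hi
  by_cases hall : ∀ j ∈ t, 0 < w j → z j = z i
  · have hxi : x = z i := by
      rw [← hzx, ← one_smul ℝ (z i), ← hw1, Finset.sum_smul]
      refine Finset.sum_congr rfl fun j hj => ?_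
      rcases (hw j hj).eq_or_lt with h0 | h0
      · simp [← h0]
      · rw [hall j hj h0]
    refine ⟨∅, by simp, fun e _ => ?_⟩
    rw [hxi, hzI]
    by_cases he : e ∈ I <;> simp [he]
  · push Not at hall
    obtain ⟨j, hj, hwj, hji⟩ := hall
    obtain ⟨J, hJ, hzJ⟩ := hz j hj
    have hIJ : I ≠ J := by
      rintro rfl
      exact hji (hzJ.trans hzI.symm)
    obtain ⟨I', J', s, hI', hJ', hne, hs, hsI, hdir⟩ := exists_double_exchange hI hJ hIJ
    have hd₁ : FeasibleDir (matroidPolytope M) x (I'.indicator 1 - I.indicator 1) := by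
      refine feasibleDir_of_pos hP hwi hwj hxP ?_ ?_
      · rw [← hzI]
        exact hmove i hi _ (indicator_mem_matroidPolytope hI')
      · rw [hdir, ← hzJ, sub_eq_add_neg, ← smul_neg, neg_sub]
        exact hmove j hj _ (indicator_mem_matroidPolytope hJ')
    have hd₂ : FeasibleDir (matroidPolytope M) x (x - z i) := by
      refine feasibleDir_of_pos hP hwi one_pos hxP (hmove i hi x hxP) ?_
      simpa using hzP i hi
    have hd₁0 : (I'.indicator 1 - I.indicator 1 : E → ℝ) ≠ 0 := by
      intro h
      refine hne (Set.ext fun e => ?_)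
      have := congrFun h e
      by_cases h1 : e ∈ I' <;> by_cases h2 : e ∈ I <;> simp_all
    set d₁ : E → ℝ := I'.indicator 1 - I.indicator 1
    have hℓ : ℓ d₁ ≠ 0 := fun h0 => hd₁0 (hd₁.eq_zero ℓ hx h0)
    have hpar := hd₁.smul_eq_smul hP ℓ hx hd₂
    refine ⟨s, hs, fun e he => ?_⟩
    have hde : d₁ e = 0 := by
      have := hsI e he
      by_cases h : e ∈ I <;> simp [d₁, this, h]
    have := congrFun hpar e
    simp only [Pi.smul_apply, hde, smul_eq_mul, mul_zero] at this
    have h0 : x e = z i e := by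
      have := (mul_eq_zero.1 this.symm).resolve_left hℓ
      simpa [sub_eq_zero] using this
    rw [h0, hzI]
    by_cases h : e ∈ I <;> simp [h]

end Vertices

/-! ### The linear program -/

section LinearProgram

variable {E : Type*}

theorem matroidPolytope_subset_Icc (M : Matroid E) : matroidPolytope M ⊆ Set.Icc 0 1 := by
  refine convexHull_min ?_ (convex_Icc 0 1)
  rintro _ ⟨B, -, rfl⟩
  exact ⟨Set.indicator_nonneg fun _ _ => zero_le_one,
    Set.indicator_le' (fun _ _ => le_rfl) fun _ _ => zero_le_one⟩

/-- Every independent set occurring in a convex combination contains all elements at which the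
combination takes its maximal value one. -/
theorem exists_indep_of_mem_matroidPolytope {M : Matroid E} {x : E → ℝ}
    (hx : x ∈ matroidPolytope M) : ∃ B : Set E, M.Indep B ∧ ∀ e, x e = 1 → e ∈ B := by
  rw [matroidPolytope, convexHull_eq] at hx
  obtain ⟨ι, t, w, z, hw, hw1, hz, hzx⟩ := hx
  rw [Finset.centerMass_eq_of_sum_1 _ _ hw1] at hzx
  obtain ⟨i, hi, hwi⟩ : ∃ i ∈ t, 0 < w i := by
    by_contra! h
    have := Finset.sum_nonpos h
    linarith
  obtain ⟨B, hB, hzB⟩ := hz i hi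
  refine ⟨B, hB, fun e he => ?_⟩
  have hz1 : ∀ k ∈ t, z k e ≤ 1 := by
    intro k hk
    obtain ⟨D, -, hD⟩ := hz k hk
    rw [hD]
    exact Set.indicator_le' (fun _ _ => le_rfl) (fun _ _ => zero_le_one) e
  have hsum : ∑ k ∈ t, w k * (1 - z k e) = 0 := by
    have : ∑ k ∈ t, w k * z k e = 1 := by
      rw [← he, ← hzx]
      simp
    simp only [mul_sub, mul_one, Finset.sum_sub_distrib, hw1, this, sub_self]
  have h0 := (Finset.sum_eq_zero_iff_of_nonneg fun k hk =>
    mul_nonneg (hw k hk) (sub_nonneg.2 (hz1 k hk))).1 hsum i hi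
  have hze : z i e = 1 := by
    have := (mul_eq_zero.1 h0).resolve_left hwi.ne'
    linarith
  by_contra heB
  simp [hzB, heB] at hze

theorem isCompact_matroidPolytope [Finite E] (M : Matroid E) : IsCompact (matroidPolytope M) := by
  have hfin : {x : E → ℝ | ∃ B : Set E, M.Indep B ∧ x = B.indicator 1}.Finite := by
    refine (Set.finite_range fun B : Set E => (B.indicator 1 : E → ℝ)).subset ?_
    rintro _ ⟨B, -, rfl⟩
    exact ⟨B, rfl⟩
  exact hfin.isCompact_convexHull ℝ

/-- The linear functional `x ↦ ∑ e ∈ s, x e * v e`. -/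
noncomputable def weightFunctional [Fintype E] (s : Finset E) (v : E → ℝ) :
    (E → ℝ) →L[ℝ] ℝ :=
  ∑ e ∈ s, v e • ContinuousLinearMap.proj (R := ℝ) (φ := fun _ : E => ℝ) e

theorem weightFunctional_apply [Fintype E] (s : Finset E) (v x : E → ℝ) :
    weightFunctional s v x = ∑ e ∈ s, x e * v e := by
  simp [weightFunctional, mul_comm]

namespace Instance

variable (K : Instance E) {ε α : ℝ} {F Q : Finset E} {x : E → ℝ}

theorem IsSolution.mono {K : Instance E} {X Y : Finset E} (hX : K.IsSolution X) (h : Y ⊆ X) :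
    K.IsSolution Y :=
  ⟨hX.1.subset (by exact_mod_cast h),
    (Finset.sum_le_sum_of_subset_of_nonneg h fun e _ _ => K.cost_nonneg e).trans hX.2⟩

theorem isSolution_empty : K.IsSolution ∅ := ⟨by simp, by simpa using K.budget_pos.le⟩

theorem sum_profit_nonneg (X : Finset E) : 0 ≤ ∑ e ∈ X, K.profit e :=
  Finset.sum_nonneg fun e _ => K.profit_nonneg e

theorem residualMatroid_indep_iff (hF : K.matroid.Indep F) {B : Set E} :
    (K.residualMatroid ε α F).Indep B ↔
      K.matroid.Indep (B ∪ F) ∧ B ⊆ K.lowProfit ε α \ (F : Set E) := by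
  rw [residualMatroid, Matroid.restrict_indep_iff, hF.contract_indep_iff]
  refine ⟨fun h => ⟨h.1.2, h.2⟩, fun h => ⟨⟨?_, h.1⟩, h.2⟩⟩
  exact Set.disjoint_left.2 fun e he => (h.2 he).2

variable [Fintype E]

theorem mem_lpVars {e : E} : e ∈ K.lpVars ε α F ↔ K.profit e ≤ 2 * ε * α ∧ e ∉ F := by
  classical
  rw [lpVars, Finset.mem_filter]
  simp [lowProfit]

theorem lpFeasible_eq : K.lpFeasible ε α F = {y ∈ matroidPolytope (K.residualMatroid ε α F) |
    (weightFunctional (K.lpVars ε α F) K.cost : (E → ℝ) →ₗ[ℝ] ℝ) y ≤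
      K.budget - ∑ e ∈ F, K.cost e} := by
  simp [lpFeasible, weightFunctional_apply]

open Classical in
theorem indicator_mem_lpFeasible (hFQ : K.IsSolution (F ∪ Q)) (hQ : Q ⊆ K.lpVars ε α F) :
    ((Q : Set E).indicator 1 : E → ℝ) ∈ K.lpFeasible ε α F := by
  have hdisj : Disjoint F Q :=
    Finset.disjoint_right.2 fun e he => (K.mem_lpVars.1 (hQ he)).2
  refine ⟨indicator_mem_matroidPolytope
    ((K.residualMatroid_indep_iff (hFQ.mono Finset.subset_union_left).1).2 ⟨?_, ?_⟩), ?_⟩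
  · rw [Set.union_comm, ← Finset.coe_union]
    exact hFQ.1
  · intro e he
    exact K.mem_lpVars.1 (hQ he)
  · have h := hFQ.2
    rw [Finset.sum_union hdisj] at h
    have : ∑ e ∈ K.lpVars ε α F, (Q : Set E).indicator (1 : E → ℝ) e * K.cost e
        = ∑ e ∈ Q, K.cost e := by
      simp [Set.indicator_apply, Finset.sum_ite_mem, Finset.inter_eq_right.2 hQ]
    rw [this]
    linarith

/-- The linear program of a solution has a basic optimal solution: the maximizers of a linear
functional form a nonempty exposed face of the compact feasible region, and a vertex of a face is a
vertex of the whole. -/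
theorem exists_isBasicOptimal (hF : K.IsSolution F) : ∃ x, K.IsBasicOptimal ε α F x := by
  classical
  have hcomp : IsCompact (K.lpFeasible ε α F) := by
    rw [lpFeasible_eq]
    exact (isCompact_matroidPolytope _).inter_right
      (isClosed_le (weightFunctional (K.lpVars ε α F) K.cost).continuous continuous_const)
  have hne : (K.lpFeasible ε α F).Nonempty :=
    ⟨_, K.indicator_mem_lpFeasible (Q := ∅) (by simpa using hF) (by simp)⟩
  set f := weightFunctional (K.lpVars ε α F) K.profit with hf
  obtain ⟨y, hy, hmax⟩ := hcomp.exists_isMaxOn hne f.continuous.continuousOn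
  have hexp : IsExposed ℝ (K.lpFeasible ε α F) (f.toExposed (K.lpFeasible ε α F)) :=
    ContinuousLinearMap.toExposed.isExposed
  obtain ⟨x, hx⟩ := (hexp.isCompact hcomp).extremePoints_nonempty ⟨y, hy, hmax⟩
  refine ⟨x, hexp.isExtreme.extremePoints_subset_extremePoints hx, fun y hy => ?_⟩
  have := hx.1.2 y hy
  simpa [hf, weightFunctional_apply] using this

theorem isSolution_extend (hF : K.IsSolution F) (hx : x ∈ K.lpFeasible ε α F) :
    K.IsSolution (K.extend ε α F x) := by
  classical
  obtain ⟨hxP, hxc⟩ := hx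
  obtain ⟨B, hB, hxB⟩ := exists_indep_of_mem_matroidPolytope hxP
  have hx0 := (matroidPolytope_subset_Icc _ hxP).1
  refine ⟨((K.residualMatroid_indep_iff hF.1).1 hB).1.subset ?_, ?_⟩
  · intro e he
    simp only [extend, Finset.coe_union, Set.mem_union, Finset.mem_coe, Finset.mem_filter] at he
    exact he.imp (fun h => hxB e h.2) id
  · have hdisj : Disjoint {e ∈ K.lpVars ε α F | x e = 1} F :=
      Finset.disjoint_left.2 fun e he => (K.mem_lpVars.1 (Finset.mem_filter.1 he).1).2
    rw [extend, Finset.sum_union hdisj]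
    have : ∑ e ∈ K.lpVars ε α F with x e = 1, K.cost e ≤
        ∑ e ∈ K.lpVars ε α F, x e * K.cost e := by
      rw [Finset.sum_filter]
      refine Finset.sum_le_sum fun e _ => ?_
      split_ifs with h
      · simp [h]
      · exact mul_nonneg (hx0 e) (K.cost_nonneg e)
    linarith

open Classical in
/-- Rounding down a basic optimal solution loses only its at most two fractional entries, each of
profit at most `2 * ε * α`. -/
theorem profit_le_profit_extend (hα : 0 ≤ 2 * ε * α) (hx : K.IsBasicOptimal ε α F x)
    (hFQ : K.IsSolution (F ∪ Q)) (hQ : Q ⊆ K.lpVars ε α F) :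
    ∑ e ∈ F, K.profit e + ∑ e ∈ Q, K.profit e ≤
      ∑ e ∈ K.extend ε α F x, K.profit e + 2 * (2 * ε * α) := by
  obtain ⟨hext, hopt⟩ := hx
  have hxP := hext.1.1
  have hx01 := matroidPolytope_subset_Icc _ hxP
  rw [lpFeasible_eq] at hext
  obtain ⟨s, hs, hfrac⟩ := exists_card_le_two_of_mem_extremePoints _ _ hext
  have hQx := hopt _ (K.indicator_mem_lpFeasible hFQ hQ)
  have hQsum : ∑ e ∈ K.lpVars ε α F, (Q : Set E).indicator (1 : E → ℝ) e * K.profit e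
      = ∑ e ∈ Q, K.profit e := by
    simp [Set.indicator_apply, Finset.sum_ite_mem, Finset.inter_eq_right.2 hQ]
  rw [hQsum] at hQx
  have hdisj : Disjoint {e ∈ K.lpVars ε α F | x e = 1} F :=
    Finset.disjoint_left.2 fun e he => (K.mem_lpVars.1 (Finset.mem_filter.1 he).1).2
  rw [extend, Finset.sum_union hdisj]
  have hround : ∑ e ∈ K.lpVars ε α F, x e * K.profit e ≤
      ∑ e ∈ K.lpVars ε α F with x e = 1, K.profit e + ∑ e ∈ s, 2 * ε * α := by
    have h1 : ∀ e ∈ K.lpVars ε α F, x e * K.profit e ≤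
        (if x e = 1 then K.profit e else 0) + if e ∈ s then 2 * ε * α else 0 := by
      intro e he
      have hlow := (K.mem_lpVars.1 he).1
      by_cases h1 : x e = 1
      · rw [if_pos h1, h1, one_mul]
        split_ifs <;> linarith
      · rw [if_neg h1, zero_add]
        by_cases hes : e ∈ s
        · rw [if_pos hes]
          exact (mul_le_of_le_one_left (K.profit_nonneg e) (hx01.2 e)).trans hlow
        · rw [if_neg hes, (hfrac e hes).resolve_right h1, zero_mul]
    refine (Finset.sum_le_sum h1).trans ?_
    rw [Finset.sum_add_distrib, ← Finset.sum_filter, ← Finset.sum_filter]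
    refine add_le_add le_rfl ?_
    exact Finset.sum_le_sum_of_subset_of_nonneg (fun e he => (Finset.mem_filter.1 he).2)
      fun _ _ _ => hα
  have hcard : ∑ e ∈ s, 2 * ε * α ≤ 2 * (2 * ε * α) := by
    rw [Finset.sum_const, nsmul_eq_mul]
    gcongr
    exact_mod_cast hs
  linarith

end Instance

end LinearProgram

/-! ### Minimum-cost bases of a union of truncated restrictions to disjoint classes -/

section Classes

variable {E : Type*} {M : Matroid E} {s : Finset ℕ} {C : ℕ → Set E} {q : ℝ}

open Classical in
/-- As the classes are disjoint, a set lies in the union of the truncated restrictions if and only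
if it is covered by the classes and its part in every class is independent and small. -/
theorem mem_familyUnion_truncation_iff (hC : (s : Set ℕ).PairwiseDisjoint C) {A : Finset E} :
    A ∈ familyUnion s (fun r => truncation (indepSets (M.restrict (C r))) q) ↔
      (∀ e ∈ A, ∃ r ∈ s, e ∈ C r) ∧
        ∀ r ∈ s, M.Indep ({e ∈ A | e ∈ C r} : Finset E) ∧ ((A.filter (· ∈ C r)).card : ℝ) ≤ q := by
  constructor
  · rintro ⟨B, hB, rfl⟩
    have hBC : ∀ r ∈ s, ∀ e ∈ B r, e ∈ C r := fun r hr e he => (hB r hr).1.2 he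
    refine ⟨fun e he => ?_, fun r hr => ?_⟩
    · obtain ⟨r, hr, her⟩ := Finset.mem_biUnion.1 he
      exact ⟨r, hr, hBC r hr e her⟩
    · have : (s.biUnion B).filter (· ∈ C r) = B r := by
        ext e
        simp only [Finset.mem_filter, Finset.mem_biUnion]
        constructor
        · rintro ⟨⟨r', hr', he⟩, her⟩
          rwa [← hC.elim_set hr' hr e (hBC r' hr' e he) her]
        · exact fun he => ⟨⟨r, hr, he⟩, hBC r hr e he⟩
      rw [this]
      exact ⟨(hB r hr).1.1, (hB r hr).2⟩
  · rintro ⟨hA, hAr⟩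
    refine ⟨fun r => A.filter (· ∈ C r), fun r hr => ⟨⟨(hAr r hr).1, ?_⟩, (hAr r hr).2⟩, ?_⟩
    · intro e he
      exact (Finset.mem_filter.1 he).2
    · ext e
      simp only [Finset.mem_biUnion, Finset.mem_filter]
      exact ⟨fun he => (hA e he).imp fun r hr => ⟨hr.1, he, hr.2⟩, fun ⟨_, _, he, _⟩ => he⟩

open Classical in
/-- Replacing the part of a member inside one class. -/
theorem mem_familyUnion_of_eq_off_class (hC : (s : Set ℕ).PairwiseDisjoint C) {A R : Finset E}
    (hR : R ∈ familyUnion s (fun r => truncation (indepSets (M.restrict (C r))) q)) {r : ℕ}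
    (hr : r ∈ s) (hAR : ∀ e, e ∉ C r → (e ∈ A ↔ e ∈ R))
    (hA : M.Indep ({e ∈ A | e ∈ C r} : Finset E)) (hAq : ((A.filter (· ∈ C r)).card : ℝ) ≤ q) :
    A ∈ familyUnion s (fun r => truncation (indepSets (M.restrict (C r))) q) := by
  rw [mem_familyUnion_truncation_iff hC] at hR ⊢
  refine ⟨fun e he => ?_, fun r' hr' => ?_⟩
  · by_cases her : e ∈ C r
    · exact ⟨r, hr, her⟩
    · exact hR.1 e ((hAR e her).1 he)
  · by_cases h : r' = r
    · subst h
      exact ⟨hA, hAq⟩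
    · have : A.filter (· ∈ C r') = R.filter (· ∈ C r') := by
        ext e
        simp only [Finset.mem_filter]
        refine and_congr_left fun he => hAR e fun her => h ?_
        exact hC.elim_set hr' hr e he her
      rw [this]
      exact hR.2 r' hr'

open Classical in
/-- In every class, a basis of the family has at least as many elements as any small independent
subset of the class: otherwise the basis could be augmented inside the class. -/
theorem card_le_card_filter_of_isBasis (hC : (s : Set ℕ).PairwiseDisjoint C) {R : Finset E}
    (hR : IsBasis (familyUnion s (fun r => truncation (indepSets (M.restrict (C r))) q)) R) {r : ℕ}
    (hr : r ∈ s) {A : Finset E} (hA : M.Indep (A : Set E)) (hAC : ∀ e ∈ A, e ∈ C r)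
    (hAq : (A.card : ℝ) ≤ q) : A.card ≤ (R.filter (· ∈ C r)).card := by
  by_contra! hlt
  have hRr := ((mem_familyUnion_truncation_iff hC).1 hR.1).2 r hr
  obtain ⟨e, heA, heR, hind⟩ := hRr.1.augment_finset hA hlt
  have heR' : e ∉ R := fun h => heR (Finset.mem_filter.2 ⟨h, hAC e heA⟩)
  have hfil : (insert e R).filter (· ∈ C r) = insert e (R.filter (· ∈ C r)) := by
    rw [Finset.filter_insert, if_pos (hAC e heA)]
  refine hR.2 e heR' (mem_familyUnion_of_eq_off_class hC hR.1 hr ?_ ?_ ?_)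
  · intro f hf
    have : f ≠ e := fun h => hf (h ▸ hAC e heA)
    simp [this]
  · rw [hfil]
    exact_mod_cast hind
  · rw [hfil, Finset.card_insert_of_notMem heR]
    exact le_trans (by exact_mod_cast hlt) hAq

open Classical in
/-- Members of the family with at least as many elements as a basis are bases: by
`card_le_card_filter_of_isBasis`, no member has more elements than a basis. -/
theorem isBasis_of_card_le (hC : (s : Set ℕ).PairwiseDisjoint C) {A R : Finset E}
    (hR : IsBasis (familyUnion s (fun r => truncation (indepSets (M.restrict (C r))) q)) R)
    (hA : A ∈ familyUnion s (fun r => truncation (indepSets (M.restrict (C r))) q))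
    (hcard : R.card ≤ A.card) :
    IsBasis (familyUnion s (fun r => truncation (indepSets (M.restrict (C r))) q)) A := by
  refine ⟨hA, fun e he hins => ?_⟩
  have key : ∀ D ∈ familyUnion s (fun r => truncation (indepSets (M.restrict (C r))) q),
      D.card ≤ R.card := by
    intro D hD
    have hD' := (mem_familyUnion_truncation_iff hC).1 hD
    have hcov : D = s.biUnion fun r => D.filter (· ∈ C r) := by
      ext e
      simp only [Finset.mem_biUnion, Finset.mem_filter]
      exact ⟨fun he => (hD'.1 e he).imp fun r hr => ⟨hr.1, he, hr.2⟩, fun ⟨_, _, he, _⟩ => he⟩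
    calc D.card ≤ ∑ r ∈ s, (D.filter (· ∈ C r)).card := by
          conv_lhs => rw [hcov]
          exact Finset.card_biUnion_le
      _ ≤ ∑ r ∈ s, (R.filter (· ∈ C r)).card :=
          Finset.sum_le_sum fun r hr => card_le_card_filter_of_isBasis hC hR hr (hD'.2 r hr).1
            (fun e he => (Finset.mem_filter.1 he).2) (hD'.2 r hr).2
      _ = (s.biUnion fun r => R.filter (· ∈ C r)).card := by
          refine (Finset.card_biUnion fun r hr r' hr' hne => ?_).symm
          refine Finset.disjoint_left.2 fun e he he' => hne ?_
          exact hC.elim_set hr hr' e (Finset.mem_filter.1 he).2 (Finset.mem_filter.1 he').2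
      _ ≤ R.card :=
          Finset.card_le_card (Finset.biUnion_subset.2 fun r _ => Finset.filter_subset _ _)
  have := key _ hins
  rw [Finset.card_insert_of_notMem he] at this
  omega

open Classical in
/-- A minimum-cost basis is a representative set: an element `e` of a class in a small independent
set `L` can be exchanged with an element of the basis in the same class which costs no more. If all
elements of the basis in the class of cost at most `c e` were spanned by `L \ {e}`, then `e` could
replace a more expensive element of the basis. -/
theorem exists_exchange_of_isMinBasis (hC : (s : Set ℕ).PairwiseDisjoint C) {c : E → ℝ}
    {R : Finset E}
    (hR : IsMinBasis (familyUnion s (fun r => truncation (indepSets (M.restrict (C r))) q)) c R)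
    {r : ℕ} (hr : r ∈ s) {L : Finset E} (hL : M.Indep (L : Set E)) (hLq : (L.card : ℝ) ≤ q) {e : E}
    (heL : e ∈ L) (heC : e ∈ C r) (heR : e ∉ R) :
    ∃ f ∈ R, f ∈ C r ∧ c f ≤ c e ∧ f ∉ L ∧ M.Indep (insert f (L.erase e) : Finset E) := by
  by_contra! hcon
  set B := R.filter (· ∈ C r) with hB
  have hRr := ((mem_familyUnion_truncation_iff hC).1 hR.1.1).2 r hr
  set D := B.filter (fun f => c f ≤ c e) with hD
  have heE : e ∈ M.E := hL.subset_ground heL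
  have hLe : M.Indep (L.erase e : Set E) := hL.subset (by simp)
  have hDcl : (D : Set E) ⊆ M.closure (L.erase e : Set E) := by
    intro f hf
    obtain ⟨hfB, hfc⟩ := Finset.mem_filter.1 hf
    obtain ⟨hfR, hfC⟩ := Finset.mem_filter.1 hfB
    have hfE : f ∈ M.E := hRr.1.subset_ground hfB
    by_cases hfL : f ∈ L
    · exact M.mem_closure_of_mem
        (Finset.mem_coe.2 (Finset.mem_erase.2 ⟨fun h => heR (h ▸ hfR), hfL⟩)) hLe.subset_ground
    · by_contra hfcl
      refine hcon f hfR hfC hfc hfL ?_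
      rw [Finset.coe_insert]
      exact (hLe.notMem_closure_iff_of_notMem (fun h => hfL (Finset.mem_of_mem_erase h)) hfE).1 hfcl
  have heD : e ∉ M.closure (D : Set E) := by
    intro h
    have := M.closure_subset_closure_of_subset_closure hDcl h
    rw [Finset.coe_erase] at this
    exact hL.notMem_closure_sdiff_of_mem heL this
  have heB : e ∉ B := fun h => heR (Finset.mem_filter.1 h).1
  have hDB : D ⊆ B := Finset.filter_subset _ _
  have hDind : M.Indep (D : Set E) := hRr.1.subset (by exact_mod_cast hDB)
  have heD' : e ∉ D := fun h => heB (hDB h)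
  have hDe : M.Indep (insert e D : Finset E) := by
    rw [Finset.coe_insert]
    exact (hDind.notMem_closure_iff_of_notMem (by exact_mod_cast heD') heE).1 heD
  have hDcard : (insert e D).card ≤ L.card := by
    have h1 : (D : Set E).encard ≤ (L.erase e : Set E).encard := by
      rw [← hDind.eRk_eq_encard, ← hLe.eRk_eq_encard, ← M.eRk_closure_eq (L.erase e : Set E)]
      exact M.eRk_mono hDcl
    simp only [Set.encard_coe_eq_coe_finsetCard, Nat.cast_le] at h1
    rw [Finset.card_erase_of_mem heL] at h1
    have := Finset.card_pos.2 ⟨e, heL⟩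
    rw [Finset.card_insert_of_notMem heD']
    omega
  have hle : (insert e D).card ≤ B.card := by
    refine card_le_card_filter_of_isBasis hC hR.1 hr hDe ?_
      (le_trans (by exact_mod_cast hDcard) hLq)
    intro f hf
    rcases Finset.mem_insert.1 hf with rfl | hf
    · exact heC
    · exact (Finset.mem_filter.1 (hDB hf)).2
  have hne : (D : Set E) ≠ B := by
    intro h
    rw [Finset.coe_inj.1 h, Finset.card_insert_of_notMem heB] at hle
    omega
  obtain ⟨g, ⟨hgB, hgD⟩, hind⟩ := exists_indep_exchange hRr.1 (by exact_mod_cast hDB) hne heE heD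
    (by exact_mod_cast heB)
  obtain ⟨hgR, hgC⟩ := Finset.mem_filter.1 (Finset.mem_coe.1 hgB)
  have hgc : c e < c g := by
    by_contra! h
    exact hgD (Finset.mem_coe.2 (Finset.mem_filter.2 ⟨hgB, h⟩))
  have hge : g ≠ e := fun h => heR (h ▸ hgR)
  -- exchanging `g` for `e` turns the basis into a cheaper one
  set R' := insert e (R.erase g) with hR'
  have heg : e ∉ R.erase g := fun h => heR (Finset.mem_of_mem_erase h)
  have hcard : R'.card = R.card := by
    rw [hR', Finset.card_insert_of_notMem heg, Finset.card_erase_add_one hgR]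
  have hfil : R'.filter (· ∈ C r) = (insert e B).erase g := by
    ext f
    by_cases hfe : f = e
    · subst hfe
      simp [hR', heC, hge.symm]
    · simp [hR', hB, hfe]
      tauto
  have hR'mem : R' ∈ familyUnion s (fun r => truncation (indepSets (M.restrict (C r))) q) := by
    refine mem_familyUnion_of_eq_off_class hC hR.1.1 hr ?_ ?_ ?_
    · intro f hf
      have h1 : f ≠ e := fun h => hf (h ▸ heC)
      have h2 : f ≠ g := fun h => hf (h ▸ hgC)
      simp [hR', h1, h2]
    · rw [hfil, Finset.coe_erase, Finset.coe_insert]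
      exact hind
    · rw [hfil, Finset.card_erase_of_mem (Finset.mem_insert_of_mem hgB),
        Finset.card_insert_of_notMem heB, Nat.add_sub_cancel]
      exact hRr.2
  have hmin := hR.2 R' (isBasis_of_card_le hC hR.1 hR'mem hcard.ge)
  rw [hR', Finset.sum_insert heg, ← Finset.add_sum_erase _ _ hgR] at hmin
  linarith

theorem exists_isMinBasis [Finite E] {I : Set (Finset E)} (hI : I.Nonempty) (w : E → ℝ) :
    ∃ B, IsMinBasis I w B := by
  classical
  obtain ⟨B₀, hB₀, hmax⟩ := Set.exists_max_image I Finset.card (Set.toFinite I) hI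
  have hbasis : IsBasis I B₀ := by
    refine ⟨hB₀, fun e he hins => ?_⟩
    have := hmax _ hins
    rw [Finset.card_insert_of_notMem he] at this
    omega
  obtain ⟨B, hB, hmin⟩ := Set.exists_min_image {B | IsBasis I B} (fun B => ∑ e ∈ B, w e)
    (Set.toFinite _) ⟨B₀, hbasis⟩
  exact ⟨B, hB, hmin⟩

theorem empty_mem_familyUnion (M : Matroid E) (s : Finset ℕ) (C : ℕ → Set E) (hq : 0 ≤ q) :
    ∅ ∈ familyUnion s (fun r => truncation (indepSets (M.restrict (C r))) q) :=
  ⟨fun _ => ∅, fun _ _ => ⟨by simp [indepSets], by simpa using hq⟩, by ext; simp⟩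

end Classes

namespace Instance

variable {E : Type*} (K : Instance E) {ε α : ℝ}

/-! ### Profit classes and substitution by representatives -/

section Representatives

theorem pairwiseDisjoint_profitClass (hε : 0 < ε) (hε' : ε < 1) (α : ℝ) :
    (classIndices ε : Set ℕ).PairwiseDisjoint (K.profitClass ε α) := by
  have key : ∀ r r' : ℕ, r < r' → Disjoint (K.profitClass ε α r) (K.profitClass ε α r') := by
    intro r r' h
    refine Set.disjoint_left.2 fun e he he' => ?_
    have h1 : (1 - ε) ^ (r' - 1) ≤ (1 - ε) ^ r :=
      pow_le_pow_of_le_one (by linarith) (by linarith) (by omega)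
    exact absurd (he.1.trans_le (he'.2.trans h1)) (lt_irrefl _)
  intro r _ r' _ hne
  rcases hne.lt_or_gt with h | h
  · exact key r r' h
  · exact (key r' r h).symm

theorem mul_profit_lt_of_mem_profitClass (hε' : ε < 1) (hα : 0 < α) {r : ℕ}
    (hr : r ∈ classIndices ε) {e f : E} (he : e ∈ K.profitClass ε α r)
    (hf : f ∈ K.profitClass ε α r) : (1 - ε) * K.profit e < K.profit f := by
  have hr1 : 1 ≤ r := (Finset.mem_Icc.1 hr).1
  have h1 : (1 - ε) * (K.profit e / (2 * α)) < K.profit f / (2 * α) := by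
    refine lt_of_le_of_lt ?_ hf.1
    calc (1 - ε) * (K.profit e / (2 * α)) ≤ (1 - ε) * (1 - ε) ^ (r - 1) :=
          mul_le_mul_of_nonneg_left he.2 (by linarith)
      _ = (1 - ε) ^ r := by rw [← pow_succ', Nat.sub_add_cancel hr1]
  rw [← mul_div_assoc] at h1
  exact (div_lt_div_iff_of_pos_right (by positivity)).1 h1

/-- The profit classes cover all profits between `ε * α` and `2 * α`. -/
theorem exists_mem_profitClass (hε : 0 < ε) (hε' : ε < 1) (hα : 0 < α) {e : E}
    (h1 : ε * α ≤ K.profit e) (h2 : K.profit e ≤ 2 * α) :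
    ∃ r ∈ classIndices ε, e ∈ K.profitClass ε α r := by
  have hb : 0 < 1 - ε := by linarith
  have hy : ε / 2 ≤ K.profit e / (2 * α) := by
    rw [div_le_div_iff₀ (by norm_num) (by positivity)]
    linarith
  obtain ⟨n, hn1, hn2⟩ := exists_nat_pow_near_of_lt_one
    (x := K.profit e / (2 * α)) (y := 1 - ε) (lt_of_lt_of_le (by positivity) hy)
    ((div_le_one (by positivity)).2 h2) hb (by linarith)
  refine ⟨n + 1, Finset.mem_Icc.2 ⟨by omega, Nat.le_floor ?_⟩, hn1, hn2⟩
  have : (n : ℝ) ≤ Real.logb (1 - ε) (ε / 2) := by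
    rw [Real.le_logb_iff_rpow_le_of_base_lt_one hb (by linarith) (by positivity), Real.rpow_natCast]
    exact hy.trans hn2
  push_cast
  linarith

open Classical in
/-- Exchanging one by one the elements of a small independent set that lie in a profit class but not
in `R` for elements of `R`, at no higher cost and losing at most an `ε`-fraction of each profit. -/
theorem exists_substitution (hε : 0 < ε) (hε' : ε < 1) {S R : Finset E}
    (hα : 0 < ∑ e ∈ S, K.profit e) (hR : K.IsFindRepResult ε S R) {L : Finset E}
    (hL : K.matroid.Indep (L : Set E)) (hLq : (L.card : ℝ) ≤ sizeBound ε) :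
    ∃ L' : Finset E, K.matroid.Indep (L' : Set E) ∧ L'.card = L.card ∧
      ∑ e ∈ L', K.cost e ≤ ∑ e ∈ L, K.cost e ∧
      ∑ e ∈ L, K.profit e ≤ ∑ e ∈ L', K.profit e + ε * ∑ e ∈ L.filter (fun e => e ∉ R ∧
        ∃ r ∈ classIndices ε, e ∈ K.profitClass ε (∑ e ∈ S, K.profit e) r), K.profit e ∧
      (∀ f ∈ L', (∃ r ∈ classIndices ε, f ∈ K.profitClass ε (∑ e ∈ S, K.profit e) r) → f ∈ R) ∧
      ∀ f ∈ L', f ∈ L ∨ ∃ e ∈ L, e ∉ R ∧ (1 - ε) * K.profit e < K.profit f := by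
  set α := ∑ e ∈ S, K.profit e
  induction hn : (L.filter fun e => e ∉ R ∧
    ∃ r ∈ classIndices ε, e ∈ K.profitClass ε α r).card generalizing L with
  | zero =>
    rw [Finset.card_eq_zero] at hn
    refine ⟨L, hL, rfl, le_rfl, by simp [hn], fun f hf hfC => ?_, fun f hf => Or.inl hf⟩
    by_contra hfR
    exact Finset.notMem_empty f (hn ▸ Finset.mem_filter.2 ⟨hf, hfR, hfC⟩)
  | succ n ih =>
    obtain ⟨e, he⟩ := Finset.card_pos.1 (by rw [hn]; exact n.succ_pos)
    obtain ⟨heL, heR, r, hr, heC⟩ := Finset.mem_filter.1 he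
    obtain ⟨f, hfR, hfC, hfc, hfL, hind⟩ := exists_exchange_of_isMinBasis
      (K.pairwiseDisjoint_profitClass hε hε' α) hR hr hL hLq heL heC heR
    have hfe : f ∉ L.erase e := fun h => hfL (Finset.mem_of_mem_erase h)
    have hcard : (insert f (L.erase e)).card = L.card := by
      rw [Finset.card_insert_of_notMem hfe, Finset.card_erase_add_one heL]
    have hbad : (insert f (L.erase e)).filter (fun e => e ∉ R ∧
        ∃ r ∈ classIndices ε, e ∈ K.profitClass ε α r) = (L.filter (fun e => e ∉ R ∧
        ∃ r ∈ classIndices ε, e ∈ K.profitClass ε α r)).erase e := by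
      rw [Finset.filter_insert, if_neg (fun h => h.1 hfR), Finset.filter_erase]
    obtain ⟨L', hL', hL'card, hL'c, hL'p, hL'R, hL'f⟩ := ih (L := insert f (L.erase e)) hind
      (by rwa [hcard]) (by rw [hbad, Finset.card_erase_of_mem he, hn, Nat.add_sub_cancel])
    have hfp := K.mul_profit_lt_of_mem_profitClass hε' hα hr heC hfC
    refine ⟨L', hL', hL'card.trans hcard, hL'c.trans ?_, ?_, hL'R, fun g hg => ?_⟩
    · rw [Finset.sum_insert hfe, ← Finset.add_sum_erase _ _ heL]
      linarith
    · rw [hbad, Finset.sum_insert hfe] at hL'p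
      rw [← Finset.add_sum_erase _ _ heL, ← Finset.add_sum_erase _ _ he]
      linarith
    · rcases hL'f g hg with hg | ⟨e', he', heR', hlt⟩
      · rcases Finset.mem_insert.1 hg with rfl | hg
        · exact Or.inr ⟨e, heL, heR, hfp⟩
        · exact Or.inl (Finset.mem_of_mem_erase hg)
      · rcases Finset.mem_insert.1 he' with rfl | he'
        · exact absurd hfR heR'
        · exact Or.inr ⟨e', Finset.mem_of_mem_erase he', heR', hlt⟩

end Representatives

/-! ### A nearly optimal solution whose profitable elements are representatives -/

section Structure

/-- Among the `⌊ε⁻¹⌋ + 1` disjoint profit ranges `(ε ^ (i + 1) * t, ε ^ i * t]`, one carries at most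
an `ε`-fraction of the total profit. -/
theorem exists_negligible_range (hε : 0 < ε) (hε' : ε < 1) {t : ℝ} (ht : 0 < t) {G : Finset E}
    (hG : ∑ e ∈ G, K.profit e ≤ t) :
    ∃ i : ℕ, (i : ℝ) ≤ ε⁻¹ ∧
      ∑ e ∈ G with ε ^ (i + 1) * t < K.profit e ∧ K.profit e ≤ ε ^ i * t, K.profit e ≤ ε * t := by
  classical
  by_contra! hcon
  set W : ℕ → Finset E := fun i =>
    {e ∈ G | ε ^ (i + 1) * t < K.profit e ∧ K.profit e ≤ ε ^ i * t} with hW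
  set n := ⌊ε⁻¹⌋₊
  have hlt : ∀ i j : ℕ, i < j → Disjoint (W i) (W j) := by
    intro i j hij
    refine Finset.disjoint_left.2 fun e hi hj => ?_
    have h1 := (Finset.mem_filter.1 hi).2.1
    have h2 := (Finset.mem_filter.1 hj).2.2
    have h3 : ε ^ j * t ≤ ε ^ (i + 1) * t :=
      mul_le_mul_of_nonneg_right (pow_le_pow_of_le_one hε.le hε'.le hij) ht.le
    linarith
  have hdisj : (Finset.range (n + 1) : Set ℕ).PairwiseDisjoint W := by
    intro i _ j _ hne
    rcases hne.lt_or_gt with h | h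
    · exact hlt i j h
    · exact (hlt j i h).symm
  have hle : ∑ i ∈ Finset.range (n + 1), ∑ e ∈ W i, K.profit e ≤ t := by
    rw [← Finset.sum_biUnion hdisj]
    refine (Finset.sum_le_sum_of_subset_of_nonneg ?_ fun e _ _ => K.profit_nonneg e).trans hG
    exact Finset.biUnion_subset.2 fun i _ => Finset.filter_subset _ _
  have hge : ∑ i ∈ Finset.range (n + 1), ε * t ≤
      ∑ i ∈ Finset.range (n + 1), ∑ e ∈ W i, K.profit e := by
    refine Finset.sum_le_sum fun i hi => (hcon i ?_).le
    exact (Nat.le_floor_iff (by positivity)).1 (Nat.lt_succ_iff.1 (Finset.mem_range.1 hi))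
  rw [Finset.sum_const, Finset.card_range, nsmul_eq_mul] at hge
  have hn : ε⁻¹ < ((n + 1 : ℕ) : ℝ) := by
    push_cast
    exact Nat.lt_floor_add_one _
  have : t < ((n + 1 : ℕ) : ℝ) * (ε * t) := by
    calc t = ε⁻¹ * (ε * t) := by field_simp
      _ < _ := mul_lt_mul_of_pos_right hn (by positivity)
  linarith

variable [Fintype E]

theorem IsSolution.profit_le_opt {K : Instance E} {X : Finset E} (hX : K.IsSolution X) :
    ∑ e ∈ X, K.profit e ≤ K.opt :=
  K.isGreatest_opt.2 ⟨X, hX, rfl⟩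

theorem opt_nonneg : 0 ≤ K.opt := by
  simpa using K.isSolution_empty.profit_le_opt

theorem exists_isTwoApprox : ∃ S, K.IsTwoApprox S := by
  obtain ⟨X, hX, h⟩ := K.isGreatest_opt.1
  refine ⟨X, hX, ?_⟩
  rw [← h]
  linarith [K.opt_nonneg]

theorem exists_isFindRepResult (hε : 0 < ε) (S : Finset E) : ∃ R, K.IsFindRepResult ε S R :=
  exists_isMinBasis
    ⟨∅, empty_mem_familyUnion _ _ _ (Real.rpow_nonneg hε.le _)⟩ K.cost

open Classical in
/-- If `L'` is independent, then all but at most `L'.card` elements of an independent set `Q` can be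
added to it. -/
theorem _root_.Matroid.Indep.exists_subset_indep_union {M : Matroid E} {L' Q : Finset E}
    (hL' : M.Indep (L' : Set E)) (hQ : M.Indep (Q : Set E)) :
    ∃ Q' ⊆ Q, M.Indep (L' ∪ Q' : Finset E) ∧ (Q \ Q').card ≤ L'.card := by
  obtain ⟨T, hT, hL'T⟩ := hL'.subset_isBasis_of_subset (X := (L' ∪ Q : Set E))
    Set.subset_union_left (Set.union_subset hL'.subset_ground hQ.subset_ground)
  obtain ⟨T, rfl⟩ : ∃ T' : Finset E, (T' : Set E) = T := ⟨_, Set.coe_toFinset T⟩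
  have hL'T : L' ⊆ T := by exact_mod_cast hL'T
  have hTX : T ⊆ L' ∪ Q := by exact_mod_cast hT.subset
  have hcard : Q.card ≤ T.card := by
    have := hQ.encard_le_eRk_of_subset (Set.subset_union_right (s := (L' : Set E)))
    rw [← hT.encard_eq_eRk] at this
    simpa using this
  refine ⟨Q ∩ T, Finset.inter_subset_left, hT.indep.subset ?_, ?_⟩
  · exact_mod_cast Finset.union_subset hL'T Finset.inter_subset_right
  · have h1 : T ⊆ L' ∪ (Q ∩ T) := fun e he => by
      rcases Finset.mem_union.1 (hTX he) with h | h
      · exact Finset.mem_union_left _ h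
      · exact Finset.mem_union_right _ (Finset.mem_inter.2 ⟨h, he⟩)
    have h2 := (Finset.card_le_card h1).trans (Finset.card_union_le _ _)
    have h3 := Finset.card_sdiff_add_card_inter Q T
    rw [Finset.sdiff_inter_self_left]
    omega

/-- There is a nearly optimal solution all of whose profitable elements belong to the
representative set. From an optimal solution, drop the elements in a negligible profit range
`(ε ^ (i + 1) * OPT, ε ^ i * OPT]`. The elements above the range are at most `ε ^ (-i)` in number
and are substituted by representatives; restoring independence costs at most as many elements below
the range, of total profit at most `ε ^ (-i) * ε ^ (i + 1) * OPT`. -/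
theorem exists_solution_profitable_subset (hε : 0 < ε) (hε' : ε < 1 / 2) (hopt : 0 < K.opt)
    {R : Finset E} (hR : K.IsFindRepOutput ε R) :
    ∃ T, K.IsSolution T ∧ (1 - 3 * ε) * K.opt ≤ ∑ e ∈ T, K.profit e ∧
      ∀ e ∈ T, ε * K.opt < K.profit e → e ∈ R := by
  classical
  obtain ⟨S, hS, hR⟩ := hR
  obtain ⟨G, hG, hGopt⟩ := K.isGreatest_opt.1
  have hε1 : ε < 1 := by linarith
  set t := K.opt with ht
  have hα2 : t ≤ 2 * ∑ e ∈ S, K.profit e := by linarith [hS.2]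
  have hα1 : ∑ e ∈ S, K.profit e ≤ t := hS.1.profit_le_opt
  have hα : 0 < ∑ e ∈ S, K.profit e := by linarith
  obtain ⟨i, hi, hneg⟩ := K.exists_negligible_range hε hε1 hopt hGopt.ge
  set L := G.filter fun e => ε ^ i * t < K.profit e with hLdef
  set Q := G.filter fun e => K.profit e ≤ ε ^ (i + 1) * t with hQdef
  have hεi : 0 < ε ^ i := by positivity
  have hsucc : ε ^ (i + 1) * t ≤ (1 - ε) * (ε ^ i * t) := by
    rw [pow_succ']
    nlinarith [mul_pos hεi hopt]
  have hLG : L ⊆ G := Finset.filter_subset _ _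
  have hQG : Q ⊆ G := Finset.filter_subset _ _
  have hLQ : Disjoint L Q := Finset.disjoint_left.2 fun e h1 h2 => by
    have h1 := (Finset.mem_filter.1 h1).2
    have h2 := (Finset.mem_filter.1 h2).2
    nlinarith [mul_pos hεi hopt]
  have hGsum : t ≤ ∑ e ∈ L, K.profit e + ∑ e ∈ Q, K.profit e + ε * t := by
    have hsub : G ⊆ (L ∪ Q) ∪
        {e ∈ G | ε ^ (i + 1) * t < K.profit e ∧ K.profit e ≤ ε ^ i * t} := by
      intro e he
      simp only [L, Q, Finset.mem_union, Finset.mem_filter, he, true_and]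
      by_cases h1 : ε ^ i * t < K.profit e
      · exact Or.inl (Or.inl h1)
      · by_cases h2 : K.profit e ≤ ε ^ (i + 1) * t
        · exact Or.inl (Or.inr h2)
        · exact Or.inr ⟨not_le.1 h2, not_lt.1 h1⟩
    have h1 := Finset.sum_le_sum_of_subset_of_nonneg hsub fun e _ _ => K.profit_nonneg e
    have h2 := Finset.sum_union_inter (s₁ := L ∪ Q)
      (s₂ := {e ∈ G | ε ^ (i + 1) * t < K.profit e ∧ K.profit e ≤ ε ^ i * t}) (f := K.profit)
    have h3 := K.sum_profit_nonneg ((L ∪ Q) ∩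
      {e ∈ G | ε ^ (i + 1) * t < K.profit e ∧ K.profit e ≤ ε ^ i * t})
    rw [Finset.sum_union hLQ] at h2
    linarith
  have hLQsum : ∑ e ∈ L, K.profit e + ∑ e ∈ Q, K.profit e ≤ t := by
    rw [← Finset.sum_union hLQ]
    exact (hG.mono (Finset.union_subset hLG hQG)).profit_le_opt
  have hLcard : (L.card : ℝ) * ε ^ i ≤ 1 := by
    have h1 : ∑ e ∈ L, ε ^ i * t ≤ ∑ e ∈ L, K.profit e :=
      Finset.sum_le_sum fun e he => (Finset.mem_filter.1 he).2.le
    rw [Finset.sum_const, nsmul_eq_mul, ← mul_assoc] at h1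
    have h2 : (L.card : ℝ) * ε ^ i * t ≤ 1 * t := by linarith [K.sum_profit_nonneg Q]
    exact le_of_mul_le_mul_right h2 hopt
  have hLq : (L.card : ℝ) ≤ sizeBound ε := by
    calc (L.card : ℝ) ≤ (ε ^ i)⁻¹ := by
          rw [← one_div, le_div_iff₀ hεi]
          exact hLcard
      _ = ε ^ (-(i : ℝ)) := by rw [Real.rpow_neg hε.le, Real.rpow_natCast]
      _ ≤ sizeBound ε := Real.rpow_le_rpow_of_exponent_ge hε hε1.le (by linarith)
  obtain ⟨L', hL', hcard, hcost, hprofit, hL'R, hL'f⟩ := K.exists_substitution hε hε1 hα hR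
    (hG.mono hLG).1 hLq
  obtain ⟨Q', hQ'Q, hind, hQ'card⟩ := hL'.exists_subset_indep_union (hG.mono hQG).1
  -- a substitute is still more profitable than all elements of `Q`
  have hdisj : Disjoint L' Q' := Finset.disjoint_left.2 fun f h1 h2 => by
    have h2 := (Finset.mem_filter.1 (hQ'Q h2)).2
    rcases hL'f f h1 with h | ⟨e, he, -, h⟩
    · have h := (Finset.mem_filter.1 h).2
      nlinarith [mul_pos hεi hopt]
    · have he := (Finset.mem_filter.1 he).2
      nlinarith [mul_lt_mul_of_pos_left he (show 0 < 1 - ε by linarith)]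
  have hT : K.IsSolution (L' ∪ Q') := by
    refine ⟨hind, ?_⟩
    rw [Finset.sum_union hdisj]
    have h1 : ∑ e ∈ Q', K.cost e ≤ ∑ e ∈ Q, K.cost e :=
      Finset.sum_le_sum_of_subset_of_nonneg hQ'Q fun e _ _ => K.cost_nonneg e
    have h2 := (hG.mono (Finset.union_subset hLG hQG)).2
    rw [Finset.sum_union hLQ] at h2
    linarith
  refine ⟨L' ∪ Q', hT, ?_, fun e he hlt => ?_⟩
  · rw [Finset.sum_union hdisj]
    have h1 : ∑ e ∈ Q \ Q', K.profit e ≤ ε * t := by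
      calc ∑ e ∈ Q \ Q', K.profit e ≤ ∑ e ∈ Q \ Q', ε ^ (i + 1) * t :=
            Finset.sum_le_sum fun e he => (Finset.mem_filter.1 (Finset.mem_sdiff.1 he).1).2
        _ = ((Q \ Q').card : ℝ) * (ε ^ (i + 1) * t) := by rw [Finset.sum_const, nsmul_eq_mul]
        _ ≤ (L.card : ℝ) * (ε ^ (i + 1) * t) :=
            mul_le_mul_of_nonneg_right (Nat.cast_le.2 (hQ'card.trans hcard.le)) (by positivity)
        _ = (L.card * ε ^ i) * (ε * t) := by ring
        _ ≤ 1 * (ε * t) := mul_le_mul_of_nonneg_right hLcard (by positivity)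
        _ = ε * t := one_mul _
    have h2 := Finset.sum_sdiff (f := K.profit) hQ'Q
    have h3 : ε * ∑ e ∈ L.filter (fun e => e ∉ R ∧ ∃ r ∈ classIndices ε,
        e ∈ K.profitClass ε (∑ e ∈ S, K.profit e) r), K.profit e ≤ ε * t := by
      refine mul_le_mul_of_nonneg_left ?_ hε.le
      exact (hG.mono ((Finset.filter_subset _ _).trans hLG)).profit_le_opt
    linarith
  · have hlet : K.profit e ≤ t := by
      simpa using (hT.mono (Finset.singleton_subset_iff.2 he)).profit_le_opt
    rcases Finset.mem_union.1 he with heL | heQ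
    · refine hL'R e heL (K.exists_mem_profitClass hε hε1 hα ?_ (hlet.trans hα2))
      nlinarith
    · have h1 := (Finset.mem_filter.1 (hQ'Q heQ)).2
      have h2 : ε ^ (i + 1) ≤ ε := by
        rw [pow_succ']
        exact mul_le_of_le_one_right hε.le (pow_le_one₀ hε.le hε1.le)
      nlinarith

end Structure

/-! ### The main loop -/

section Loop

theorem profit_update_eq_max (A C : Finset E) :
    ∑ e ∈ K.update A C, K.profit e = max (∑ e ∈ A, K.profit e) (∑ e ∈ C, K.profit e) := by
  unfold update
  split_ifs with h
  · exact (max_eq_right h.le).symm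
  · exact (max_eq_left (not_lt.1 h)).symm

theorem isSolution_foldl_update {C : Finset E → Finset E} (l : List (Finset E)) {A : Finset E}
    (hA : K.IsSolution A) (hC : ∀ F ∈ l, K.IsSolution (C F)) :
    K.IsSolution (l.foldl (fun A F => K.update A (C F)) A) := by
  induction l generalizing A with
  | nil => exact hA
  | cons F l ih =>
    refine ih (?_ : K.IsSolution (K.update A (C F))) fun F' hF' =>
      hC F' (List.mem_cons_of_mem _ hF')
    unfold update
    split_ifs
    · exact hC F List.mem_cons_self
    · exact hA

theorem profit_le_profit_foldl_update (C : Finset E → Finset E) (l : List (Finset E))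
    (A : Finset E) :
    ∑ e ∈ A, K.profit e ≤ ∑ e ∈ l.foldl (fun A F => K.update A (C F)) A, K.profit e ∧
    ∀ F ∈ l, ∑ e ∈ C F, K.profit e ≤
      ∑ e ∈ l.foldl (fun A F => K.update A (C F)) A, K.profit e := by
  induction l generalizing A with
  | nil => simp
  | cons F l ih =>
    obtain ⟨h1, h2⟩ := ih (K.update A (C F))
    rw [profit_update_eq_max] at h1
    refine ⟨(le_max_left _ _).trans h1, fun F' hF' => ?_⟩
    rcases List.mem_cons.1 hF' with rfl | hF'
    · exact (le_max_right _ _).trans h1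
    · exact h2 F' hF'

variable [Fintype E]

theorem exists_isLoopResult (ε : ℝ) (R S : Finset E) : ∃ A, K.IsLoopResult ε R S A := by
  classical
  have hsol : ∀ F : Finset E, ∃ x, K.IsSolution F →
      K.IsBasicOptimal ε (∑ e ∈ S, K.profit e) F x := fun F => by
    by_cases hF : K.IsSolution F
    · obtain ⟨x, hx⟩ := K.exists_isBasicOptimal hF
      exact ⟨x, fun _ => hx⟩
    · exact ⟨0, fun h => absurd h hF⟩
  choose sol hsol using hsol
  have hmem : ∀ F, F ∈ (Finset.univ.filter (K.IsCandidate ε R)).toList ↔ K.IsCandidate ε R F := by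
    simp
  exact ⟨_, _, sol, Finset.nodup_toList _, hmem, fun F hF => hsol F ((hmem F).1 hF).2.2, rfl⟩

theorem IsLoopResult.isSolution {K : Instance E} {R S A : Finset E}
    (hA : K.IsLoopResult ε R S A) : K.IsSolution A := by
  obtain ⟨order, sol, -, hord, hsol, rfl⟩ := hA
  exact K.isSolution_foldl_update order K.isSolution_empty fun F hF =>
    K.isSolution_extend ((hord F).1 hF).2.2 (hsol F hF).1.1

/-- The loop visits the set `F` of the profitable elements of the solution given by
`exists_solution_profitable_subset`, and the remaining elements of that solution are feasible for
the linear program of `F`. -/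
theorem IsLoopResult.mul_opt_le {K : Instance E} {R S A : Finset E} (hε : 0 < ε) (hε' : ε < 1 / 2)
    (hR : K.IsFindRepOutput ε R) (hS : K.IsTwoApprox S) (hA : K.IsLoopResult ε R S A) :
    (1 - 7 * ε) * K.opt ≤ ∑ e ∈ A, K.profit e := by
  classical
  rcases K.opt_nonneg.eq_or_lt with h0 | hopt
  · rw [← h0, mul_zero]
    exact K.sum_profit_nonneg A
  obtain ⟨T, hT, hTp, hTR⟩ := K.exists_solution_profitable_subset hε hε' hopt hR
  obtain ⟨order, sol, -, hord, hsol, rfl⟩ := hA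
  set α := ∑ e ∈ S, K.profit e with hα
  have hα2 : K.opt ≤ 2 * α := by linarith [hS.2]
  have hα1 : α ≤ K.opt := hS.1.profit_le_opt
  have hεα : 0 < 2 * ε * α := by nlinarith
  set F := T.filter fun e => ¬ K.profit e ≤ 2 * ε * α with hF
  set Q := T.filter fun e => K.profit e ≤ 2 * ε * α with hQ
  have hFT : F ⊆ T := Finset.filter_subset _ _
  have hFQ : F ∪ Q = T := by
    rw [Finset.union_comm]
    exact Finset.filter_union_filter_not_eq _ T
  have hFcard : (F.card : ℝ) ≤ ε⁻¹ := by
    have h1 : ∑ e ∈ F, 2 * ε * α ≤ ∑ e ∈ F, K.profit e :=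
      Finset.sum_le_sum fun e he => (not_le.1 (Finset.mem_filter.1 he).2).le
    have h2 := (hT.mono hFT).profit_le_opt
    rw [Finset.sum_const, nsmul_eq_mul] at h1
    have h3 : ((F.card : ℝ) * ε) * (2 * α) ≤ 1 * (2 * α) := by linarith
    have h4 := le_of_mul_le_mul_right h3 (by linarith)
    rwa [← one_div, le_div_iff₀ hε]
  have hcand : K.IsCandidate ε R F := by
    refine ⟨fun e he => hTR e (hFT he) ?_, hFcard, hT.mono hFT⟩
    have := not_le.1 (Finset.mem_filter.1 he).2
    nlinarith
  have hQvars : Q ⊆ K.lpVars ε α F := fun e he => by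
    have := (Finset.mem_filter.1 he).2
    exact K.mem_lpVars.2 ⟨this, fun h => (Finset.mem_filter.1 h).2 this⟩
  have hmem := (hord F).2 hcand
  have h1 := K.profit_le_profit_extend hεα.le (hsol F hmem) (hFQ.symm ▸ hT) hQvars
  have h2 := (K.profit_le_profit_foldl_update (fun F => K.extend ε α F (sol F)) order ∅).2 F hmem
  have h3 : ∑ e ∈ F, K.profit e + ∑ e ∈ Q, K.profit e = ∑ e ∈ T, K.profit e := by
    rw [add_comm]
    exact Finset.sum_filter_add_sum_filter_not T _ _
  have h4 : ε * α ≤ ε * K.opt := mul_le_mul_of_nonneg_left hα1 hε.le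
  linarith

end Loop

end Instance

end BMI

theorem mainTheorem4 {E : Type*} [Fintype E] (K : BMI.Instance E) (ε : ℝ)
    (hε : 0 < ε) (hε' : ε < 1 / 2) :
    K.EPTASTerminates ε ∧ (∃ A : Finset E, K.IsEPTASOutput ε A) ∧
    ∀ A : Finset E, K.IsEPTASOutput ε A →
      K.IsSolution A ∧ (1 - 7 * ε) * K.opt ≤ ∑ e ∈ A, K.profit e := by
  refine ⟨⟨K.exists_isTwoApprox, fun S _ => K.exists_isFindRepResult hε S,
    fun R S _ _ => K.exists_isLoopResult ε R S⟩, ?_, ?_⟩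
  · obtain ⟨S, hS⟩ := K.exists_isTwoApprox
    obtain ⟨R, hR⟩ := K.exists_isFindRepResult hε S
    obtain ⟨A, hA⟩ := K.exists_isLoopResult ε R S
    exact ⟨A, R, S, ⟨S, hS, hR⟩, hS, hA⟩
  · rintro A ⟨R, S, hR, hS, hA⟩
    exact ⟨hA.isSolution, hA.mul_opt_le hε hε' hR hS⟩
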